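/- Let $K$ be a field of characteristic $0$ and let $X=\{x_s\}$ be a family of commuting variables indexed by an infinite totally ordered set (for instance $x_1<x_2<\cdots$). A composition is a finite, possibly empty, sequence $I=(i_1,\ldots,i_r)$ of positive integers; put $|I|=i_1+\cdots+i_r$ and $$M_I=\sum_{n_1<n_2<\cdots<n_r}x_{n_1}^{i_1}x_{n_2}^{i_2}\cdots x_{n_r}^{i_r}$$ (so $M_\emptyset=1$), and let $\mathrm{QSym}$ be the $K$-linear span of all the formal power series $M_I$, with the multiplication of formal power series. For a composition $I$ let $\epsilon_I=0^{i_1-1}1\,0^{i_2-1}1\cdots 0^{i_r-1}1$, a word in the letters $0,1$ (empty if $I$ is empty). Let $\sqcup\!\sqcup$ denote the shuffle product of words, given by $au\mathbin{\sqcup\!\sqcup}bv=a(u\mathbin{\sqcup\!\sqcup}bv)+b(au\mathbin{\sqcup\!\sqcup}v)$ for letters $a,b$ and words $u,v$, and by $u\mathbin{\sqcup\!\sqcup}\epsilon=\epsilon\mathbin{\sqcup\!\sqcup}u=u$ for the empty word $\epsilon$, and let $\langle w\,|\,p\rangle$ be the coefficient of the word $w$ in $p$. Then there exists a $K$-linear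 basis $(Z_I)$ of $\mathrm{QSym}$, indexed by all compositions $I$, with $Z_I$ homogeneous of degree $|I|$, such that for all compositions $I$ and $J$ $$Z_I Z_J=\sum_{L}\langle \epsilon_L\,|\,\epsilon_I\mathbin{\sqcup\!\sqcup}\epsilon_J\rangle\,Z_L,$$ where the sum runs over all compositions $L$ and has only finitely many nonzero terms. -/

import Mathlib

namespace BinaryShuffle

/-- The multiset of all shuffles of two words, counted with multiplicity:
`au ⧢ bv = a (u ⧢ bv) + b (au ⧢ v)` and `u ⧢ ε = ε ⧢ u = u`.
The coefficient of a word `w` in `u ⧢ v` is `(shuffle u v).count w`. -/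
def shuffle {α : Type*} : List α → List α → Multiset (List α)
  | [], v => {v}
  | a :: u, [] => {a :: u}
  | a :: u, b :: v =>
      (shuffle u (b :: v)).map (fun w => a :: w) + (shuffle (a :: u) v).map (fun w => b :: w)
termination_by u v => u.length + v.length

/-- Compositions: finite (possibly empty) sequences of positive integers. -/
abbrev Comp : Type := List ℕ+

/-- The binary word `0^{i₁-1} 1 0^{i₂-1} 1 ⋯ 0^{iᵣ-1} 1` of the composition `(i₁, …, iᵣ)`. -/
def binaryWord (I : Comp) : List (Fin 2) :=
  I.flatMap (fun i : ℕ+ => List.replicate ((i : ℕ) - 1) 0 ++ [1])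

/-- The degree `i₁ + ⋯ + iᵣ` of the composition `(i₁, …, iᵣ)`. -/
def Comp.weight (I : Comp) : ℕ :=
  (I.map (fun i : ℕ+ => (i : ℕ))).sum

/-- The exponent of the monomial `x_{n₁}^{i₁} ⋯ x_{nᵣ}^{iᵣ}`, for `n₁ < ⋯ < nᵣ`. -/
noncomputable def monomialExponent {σ : Type*} [LinearOrder σ] (I : Comp)
    (n : Fin I.length ↪o σ) : σ →₀ ℕ :=
  ∑ k, Finsupp.single (n k) (I.get k : ℕ)

/-- Distinct sequences `n₁ < ⋯ < nᵣ` give distinct monomials. -/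
theorem monomialExponent_injective {σ : Type*} [LinearOrder σ] (I : Comp) :
    Function.Injective (monomialExponent (σ := σ) I) := by
  have key : ∀ n : Fin I.length ↪o σ, ∀ s, monomialExponent I n s ≠ 0 ↔ s ∈ Set.range n := by
    intro n s
    simp only [monomialExponent, Finsupp.finsetSum_apply, ne_eq, Finset.sum_eq_zero_iff,
      Finset.mem_univ, true_implies, not_forall, Set.mem_range, Finsupp.single_apply]
    refine exists_congr fun k => ?_
    have := (I.get k).pos
    split_ifs with h <;> simp [h]
  intro m n h
  have hr : Set.range m = Set.range n := by
    ext s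
    rw [← key m s, ← key n s, h]
  exact DFunLike.coe_injective ((m.strictMono.range_inj n.strictMono).1 hr)

open Classical in
/-- The quasi-monomial function `M_I = ∑_{n₁ < ⋯ < nᵣ} x_{n₁}^{i₁} ⋯ x_{nᵣ}^{iᵣ}`, a formal power
series in variables indexed by the totally ordered set `σ`. Each monomial of this sum occurs for
exactly one sequence `n₁ < ⋯ < nᵣ`, so its coefficient is `1`. -/
noncomputable def quasiMonomial (σ K : Type*) [LinearOrder σ] [Field K] (I : Comp) :
    MvPowerSeries σ K :=
  fun d => if ∃ n : Fin I.length ↪o σ, monomialExponent I n = d then 1 else 0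

/-- Quasi-symmetric functions: the linear span of the quasi-monomial functions. Products of its
elements are taken in the algebra of formal power series. -/
noncomputable def QSym (σ K : Type*) [LinearOrder σ] [Field K] :
    Submodule K (MvPowerSeries σ K) :=
  Submodule.span K (Set.range (quasiMonomial σ K))

theorem binaryWord_injective : Function.Injective binaryWord := by
  have aux : ∀ (m n : ℕ) (u v : List (Fin 2)),
      List.replicate m 0 ++ 1 :: u = List.replicate n 0 ++ 1 :: v → m = n ∧ u = v := by
    intro m
    induction m with
    | zero => intro n u v h; cases n <;> simp_all [List.replicate_succ]
    | succ m ih =>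
      intro n u v h
      cases n with
      | zero => simp [List.replicate_succ] at h
      | succ n =>
        simp only [List.replicate_succ, List.cons_append, List.cons.injEq, true_and] at h
        simpa using ih n u v h
  intro I
  induction I with
  | nil => intro J h; cases J <;> simp_all [binaryWord]
  | cons i I ih =>
    intro J h
    cases J with
    | nil => simp [binaryWord] at h
    | cons j J =>
      simp only [binaryWord, List.flatMap_cons, List.append_assoc, List.singleton_append] at h
      obtain ⟨h1, h2⟩ := aux _ _ _ _ h
      have hij : i = j := by
        have := i.pos
        have := j.pos
        exact PNat.eq (by omega)
      rw [hij, ih h2]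

/-- Only finitely many compositions contribute to the product rule. -/
theorem finite_binaryWord_mem (s : Multiset (List (Fin 2))) :
    {L : Comp | s.count (binaryWord L) ≠ 0}.Finite := by
  refine Set.Finite.subset
    (Set.Finite.preimage binaryWord_injective.injOn s.toFinset.finite_toSet) ?_
  intro L hL
  simpa [Multiset.count_eq_zero] using hL

end BinaryShuffle

/-! Characters of the shuffle algebra correspond to group-like series, and a product of group-like
series is group-like. Let `c` be the character of `g(a, b) = exp(a + b) exp(-a)`, with `a`, `b` the
letters `0`, `1`. The product of the series `g(x_s a, x_s b)` over increasing `s` is again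
group-like. Its coefficient at a word `w` is a power series `F_w` in the `x_s`, so `F_u F_v` is the
sum of `F_w` over the shuffles `w` of `u` and `v` (`isCharacter_blockSeries`). The coefficient of a
monomial in `F_w` is the product of `c` over the blocks into which the nonzero exponents cut `w`, so
it depends only on the composition of exponents. Any character gives this product rule; the choice
of `g` makes `Z_I = F_{ε_I}` a basis. Since `c(0^n) = 0` for `n > 0` and `c(0^{n-1} 1) = 1/n!`, the
expansion of `Z_I` in the `M_J` is lexicographically triangular with nonzero diagonal
(`le_of_transitionCoeff_ne_zero`, `transitionCoeff_self_ne_zero`). Shuffles of words ending in `1`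
end in `1`, so no other words enter the products. -/

namespace BinaryShuffle

/-! ### Characters of the shuffle algebra and their convolution. -/

section Characters

variable {α R : Type*}

/-- The sum of `f` over all shuffles of two words, with multiplicity. -/
def shuffleSum [AddCommMonoid R] (f : List α → R) (u v : List α) : R :=
  ((shuffle u v).map f).sum

@[simp]
theorem shuffle_nil_left (v : List α) : shuffle [] v = {v} := by
  simp [shuffle]

@[simp]
theorem shuffle_nil_right (u : List α) : shuffle u [] = {u} := by
  cases u <;> simp [shuffle]

theorem shuffle_cons_cons (a b : α) (u v : List α) :
    shuffle (a :: u) (b :: v) =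
      (shuffle u (b :: v)).map (fun w => a :: w) + (shuffle (a :: u) v).map (fun w => b :: w) := by
  rw [shuffle]

section AddCommMonoid

variable [AddCommMonoid R]

@[simp]
theorem shuffleSum_nil_left (f : List α → R) (v : List α) : shuffleSum f [] v = f v := by
  simp [shuffleSum]

@[simp]
theorem shuffleSum_nil_right (f : List α → R) (u : List α) : shuffleSum f u [] = f u := by
  simp [shuffleSum]

theorem shuffleSum_cons_cons (f : List α → R) (a b : α) (u v : List α) :
    shuffleSum f (a :: u) (b :: v) =
      shuffleSum (fun w => f (a :: w)) u (b :: v) + shuffleSum (fun w => f (b :: w)) (a :: u) v := by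
  simp [shuffleSum, shuffle_cons_cons]

theorem shuffleSum_add (f g : List α → R) (u v : List α) :
    shuffleSum (fun w => f w + g w) u v = shuffleSum f u v + shuffleSum g u v :=
  Multiset.sum_map_add

end AddCommMonoid

theorem perm_of_mem_shuffle {u v w : List α} (h : w ∈ shuffle u v) : w.Perm (u ++ v) := by
  induction u, v using shuffle.induct generalizing w with
  | case1 v => simp_all
  | case2 a u => simp_all
  | case3 a u b v ih₁ ih₂ =>
    simp only [shuffle_cons_cons, Multiset.mem_add, Multiset.mem_map] at h
    obtain ⟨w, hw, rfl⟩ | ⟨w, hw, rfl⟩ := h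
    · exact (ih₁ hw).cons a
    · exact ((ih₂ hw).cons b).trans List.perm_middle.symm

theorem card_shuffle (u v : List α) :
    (shuffle u v).card = (u.length + v.length).choose u.length := by
  induction u, v using shuffle.induct with
  | case1 v => simp
  | case2 a u => simp
  | case3 a u b v ih₁ ih₂ =>
    simp only [shuffle_cons_cons, Multiset.card_add, Multiset.card_map, ih₁, ih₂,
      List.length_cons]
    rw [show u.length + 1 + (v.length + 1) = (u.length + (v.length + 1)) + 1 by ring,
      Nat.choose_succ_succ, show u.length + 1 + v.length = u.length + (v.length + 1) by ring]

variable [CommSemiring R]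

/-- A function on words is a character if its linear extension is multiplicative for the
shuffle product. -/
structure IsCharacter (f : List α → R) : Prop where
  map_nil : f [] = 1
  map_shuffle (u v : List α) : shuffleSum f u v = f u * f v

/-- The convolution of two functions on words, dual to deconcatenation. -/
def convolution (f g : List α → R) (w : List α) : R :=
  ∑ k ∈ Finset.range (w.length + 1), f (w.take k) * g (w.drop k)

theorem convolution_nil (f g : List α → R) : convolution f g [] = f [] * g [] := by
  simp [convolution]

theorem convolution_cons (f g : List α → R) (a : α) (w : List α) :
    convolution f g (a :: w) = f [] * g (a :: w) + convolution (fun u => f (a :: u)) g w := by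
  rw [convolution, List.length_cons, Finset.sum_range_succ', add_comm]
  rfl

theorem shuffleSum_mul_left (r : R) (f : List α → R) (u v : List α) :
    shuffleSum (fun w => r * f w) u v = r * shuffleSum f u v :=
  Multiset.sum_map_mul_left

/-- Deconcatenation is compatible with the shuffle product. -/
theorem shuffleSum_convolution (f g : List α → R) (u v : List α) :
    shuffleSum (convolution f g) u v =
      ∑ i ∈ Finset.range (u.length + 1), ∑ j ∈ Finset.range (v.length + 1),
        shuffleSum f (u.take i) (v.take j) * shuffleSum g (u.drop i) (v.drop j) := by
  -- Removing the first letter `a` replaces `f` by `fun w => f (a :: w)`, so `f` must vary.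
  induction u, v using shuffle.induct generalizing f with
  | case1 v => simp [convolution]
  | case2 a u => simp [convolution]
  | case3 a u b v ih₁ ih₂ =>
    simp only [shuffleSum_cons_cons (convolution f g), convolution_cons, shuffleSum_add,
      shuffleSum_mul_left, ih₁, ih₂]
    simp only [List.length_cons, Finset.sum_range_succ' _ (u.length + 1),
      Finset.sum_range_succ' _ (v.length + 1), List.take_succ_cons, List.drop_succ_cons,
      List.take_zero, List.drop_zero, shuffleSum_nil_left, shuffleSum_nil_right,
      shuffleSum_cons_cons f, shuffleSum_cons_cons g, add_mul, Finset.sum_add_distrib]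
    ring

theorem IsCharacter.convolution {f g : List α → R} (hf : IsCharacter f) (hg : IsCharacter g) :
    IsCharacter (convolution f g) where
  map_nil := by rw [convolution_nil, hf.map_nil, hg.map_nil, one_mul]
  map_shuffle u v := by
    simp only [shuffleSum_convolution, hf.map_shuffle, hg.map_shuffle,
      BinaryShuffle.convolution, Finset.sum_mul_sum]
    exact Finset.sum_congr rfl fun i _ => Finset.sum_congr rfl fun j _ => by ring

theorem shuffleSum_congr {f g : List α → R} {u v : List α}
    (h : ∀ w : List α, w.Perm (u ++ v) → f w = g w) : shuffleSum f u v = shuffleSum g u v :=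
  congrArg _ (Multiset.map_congr rfl fun w hw => h w (perm_of_mem_shuffle hw))

/-- Multiplying a character by a monoid morphism from words to a commutative monoid gives a
character. -/
theorem IsCharacter.mul_prod {f : List α → R} (hf : IsCharacter f) (g : α → R) :
    IsCharacter fun w => (w.map g).prod * f w where
  map_nil := by simp [hf.map_nil]
  map_shuffle u v := by
    rw [shuffleSum_congr (g := fun w => ((u ++ v).map g).prod * f w)
      fun w hw => by rw [(hw.map g).prod_eq], shuffleSum_mul_left, hf.map_shuffle]
    simp only [List.map_append, List.prod_append]
    ring

theorem IsCharacter.comp_ringHom {S : Type*} [CommSemiring S] {f : List α → R}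
    (hf : IsCharacter f) (φ : R →+* S) : IsCharacter fun w => φ (f w) where
  map_nil := by simp [hf.map_nil]
  map_shuffle u v := by
    rw [← map_mul, ← hf.map_shuffle, shuffleSum, shuffleSum, map_multiset_sum, Multiset.map_map]
    rfl

end Characters

/-! ### The character of `exp (a + b) exp (-a)`. -/

section BlockCharacter

variable (K : Type*) [Field K]

/-- Words of lengths `m` and `n` have `(m + n).choose m` shuffles, all of length `m + n`. -/
theorem isCharacter_inv_factorial (α : Type*) [CharZero K] :
    IsCharacter fun w : List α => ((w.length.factorial : K)⁻¹) where
  map_nil := by simp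
  map_shuffle u v := by
    rw [shuffleSum_congr (g := fun w => (((u ++ v).length.factorial : K)⁻¹))
      fun w hw => by rw [hw.length_eq]]
    simp only [shuffleSum, Multiset.map_const', Multiset.sum_replicate, card_shuffle,
      List.length_append, nsmul_eq_mul]
    rw [Nat.cast_add_choose]
    have := Nat.factorial_ne_zero
    have h (n : ℕ) : (n.factorial : K) ≠ 0 := Nat.cast_ne_zero.2 (this n)
    field_simp [h]

/-- The coefficients of the group-like series `exp (a + b) exp (-a)`, where `a` and `b` are the
letters `0` and `1`. -/
noncomputable def blockCharacter : List (Fin 2) → K :=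
  convolution (fun w => (w.length.factorial : K)⁻¹)
    (fun w => (w.map ![-1, 0]).prod * (w.length.factorial : K)⁻¹)

/-- Every nonempty suffix contains the final `1`, on which `exp (-a)` vanishes, so only the cut with
empty suffix survives. -/
theorem blockCharacter_append_one (w : List (Fin 2)) :
    blockCharacter K (w ++ [1]) = ((w.length + 1).factorial : K)⁻¹ := by
  rw [blockCharacter, convolution, Finset.sum_range_succ, Finset.sum_eq_zero]
  · simp
  · intro k hk
    have hk : k ≤ w.length := by simpa [Nat.lt_succ_iff] using hk
    simp [List.drop_append_of_le_length hk]

variable [CharZero K]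

theorem isCharacter_blockCharacter : IsCharacter (blockCharacter K) :=
  (isCharacter_inv_factorial K _).convolution ((isCharacter_inv_factorial K _).mul_prod _)

/-- On powers of `a` only the series at `b = 0` matters, and `exp a * exp (-a) = 1`. -/
theorem blockCharacter_replicate_zero {n : ℕ} (hn : n ≠ 0) :
    blockCharacter K (List.replicate n 0) = 0 := by
  have h (n : ℕ) : (n.factorial : K) ≠ 0 := Nat.cast_ne_zero.2 n.factorial_ne_zero
  have key : ∑ k ∈ Finset.range (n + 1), (-1 : K) ^ k * n.choose k = 0 := by
    exact_mod_cast congrArg (Int.cast : ℤ → K) (Int.alternating_sum_range_choose_of_ne hn)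
  rw [← mul_zero ((n.factorial : K)⁻¹), ← key, Finset.mul_sum,
    ← Finset.sum_range_reflect, blockCharacter, convolution, List.length_replicate]
  refine Finset.sum_congr rfl fun k hk => ?_
  have hk : k ≤ n := Nat.lt_succ_iff.1 (Finset.mem_range.1 hk)
  have hs : n + 1 - 1 - k = n - k := by omega
  rw [hs, Nat.choose_symm hk, Nat.cast_choose K hk]
  simp only [List.take_replicate, List.drop_replicate, List.length_replicate, List.map_replicate,
    List.prod_replicate, min_eq_left hk, Matrix.cons_val_zero]
  field_simp [h]

end BlockCharacter

/-! ### Ordered products over variables and the resulting power series. -/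

section QuasiSymmetricSeries

variable {α R : Type*} [CommSemiring R]

/-- The product of the values of `c` on the consecutive blocks of lengths `l` of a word, which is
zero if these blocks do not exhaust the word. -/
def blockCoeff (c : List α → R) : List ℕ → List α → R
  | [], w => if w.isEmpty then 1 else 0
  | n :: l, w => if n ≤ w.length then c (w.take n) * blockCoeff c l (w.drop n) else 0

theorem sum_eq_length_of_blockCoeff_ne_zero {c : List α → R} {l : List ℕ} {w : List α}
    (h : blockCoeff c l w ≠ 0) : l.sum = w.length := by
  induction l generalizing w with
  | nil => simp_all [blockCoeff]
  | cons n l ih =>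
    rw [blockCoeff] at h
    split_ifs at h with hn
    · have := ih (right_ne_zero_of_mul h)
      simp only [List.length_drop] at this
      simp only [List.sum_cons]
      omega
    · exact absurd rfl h

theorem blockCoeff_filter_ne_zero {c : List α → R} (hc : c [] = 1) (l : List ℕ) (w : List α) :
    blockCoeff c (l.filter (· ≠ 0)) w = blockCoeff c l w := by
  induction l generalizing w with
  | nil => rfl
  | cons n l ih => cases n <;> simp_all [blockCoeff]

variable {σ : Type*}

/-- The product over the variables `x_s`, for `s` in a list, of the series
`∑ w, c w • x_s ^ |w| • w`, as a function of the word. -/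
noncomputable def orderedProduct (c : List α → R) : List σ → List α → MvPowerSeries σ R
  | [], w => if w.isEmpty then 1 else 0
  | s :: l, w => convolution (fun u => MvPowerSeries.monomial (Finsupp.single s u.length) (c u))
      (orderedProduct c l) w

theorem isCharacter_isEmpty : IsCharacter fun w : List α => if w.isEmpty then (1 : R) else 0 where
  map_nil := by simp
  map_shuffle u v := by
    rw [shuffleSum_congr (g := fun w => if (u ++ v).isEmpty then (1 : R) else 0)
      fun w hw => by rw [hw.isEmpty_eq]]
    cases u <;> cases v <;> simp [shuffleSum]

theorem isCharacter_orderedProduct {c : List α → R} (hc : IsCharacter c) (l : List σ) :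
    IsCharacter (orderedProduct c l) := by
  induction l with
  | nil =>
    have heq : orderedProduct (σ := σ) c [] = fun w => if w.isEmpty then 1 else 0 :=
      funext fun w => by rw [orderedProduct]
    rw [heq]
    exact isCharacter_isEmpty
  | cons s l ih =>
    have heq : orderedProduct c (s :: l) =
        convolution (fun u => MvPowerSeries.monomial (Finsupp.single s u.length) (c u))
          (orderedProduct c l) :=
      funext fun w => by rw [orderedProduct]
    rw [heq]
    refine IsCharacter.convolution ?_ ih
    have h (w : List α) : MvPowerSeries.monomial (Finsupp.single s w.length) (c w) =
        (w.map fun _ => MvPowerSeries.X s).prod * MvPowerSeries.C (c w) := by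
      rw [List.map_const', List.prod_replicate, MvPowerSeries.X_pow_eq,
        ← MvPowerSeries.monomial_zero_eq_C_apply, MvPowerSeries.monomial_mul_monomial,
        add_zero, one_mul]
    simp only [h]
    exact (hc.comp_ringHom MvPowerSeries.C).mul_prod _

open MvPowerSeries in
theorem coeff_orderedProduct_eq_zero {c : List α → R} {l : List σ} {w : List α} {d : σ →₀ ℕ}
    {s : σ} (hs : s ∉ l) (hd : d s ≠ 0) : coeff d (orderedProduct c l w) = 0 := by
  classical
  induction l generalizing w d with
  | nil =>
    have : d ≠ 0 := fun h => hd (by simp [h])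
    rw [orderedProduct]
    split_ifs <;> simp [coeff_one, this]
  | cons t l ih =>
    simp only [List.mem_cons, not_or] at hs
    rw [orderedProduct, convolution, map_sum]
    refine Finset.sum_eq_zero fun k _ => ?_
    rw [coeff_monomial_mul]
    split_ifs
    · rw [ih hs.2, mul_zero]
      simpa [Finsupp.single_apply, Ne.symm hs.1] using hd
    · rfl

open MvPowerSeries in
theorem coeff_orderedProduct {c : List α → R} {l : List σ} (hl : l.Nodup) (w : List α)
    {d : σ →₀ ℕ} (hd : ∀ s ∈ d.support, s ∈ l) :
    coeff d (orderedProduct c l w) = blockCoeff c (l.map d) w := by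
  classical
  induction l generalizing w d with
  | nil =>
    have : d = 0 := by ext s; simpa using hd s
    rw [orderedProduct, List.map_nil, blockCoeff]
    split_ifs <;> simp [this]
  | cons s l ih =>
    obtain ⟨hs, hl⟩ := List.nodup_cons.1 hl
    -- If the factor of `s` takes fewer than `d s` letters, a positive power of `x_s` is left for
    -- the other variables, none of which is `s`.
    have herase : ∀ k ≤ d s, k ≠ d s → ∀ v : List α,
        coeff (d - Finsupp.single s k) (orderedProduct c l v) = 0 := fun k hk hk' v =>
      coeff_orderedProduct_eq_zero hs (by simp; omega)
    have hmap : l.map (d - Finsupp.single s (d s)) = l.map d := by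
      refine List.map_congr_left fun t ht => ?_
      have : s ≠ t := fun h => hs (h ▸ ht)
      simp [this]
    have hterm (k : ℕ) (hk : k ≤ w.length) :
        coeff d (monomial (Finsupp.single s (w.take k).length) (c (w.take k)) *
          orderedProduct c l (w.drop k)) =
        if k = d s then c (w.take k) * blockCoeff c (l.map d) (w.drop k) else 0 := by
      rw [coeff_monomial_mul, List.length_take, min_eq_left hk]
      simp only [Finsupp.single_le_iff]
      split_ifs with h₁ h₂ h₂
      · rw [h₂, ih hl, hmap]
        intro t ht
        have hts : t ≠ s := by rintro rfl; simp at ht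
        have htd : t ∈ d.support := by
          rw [Finsupp.mem_support_iff] at ht ⊢
          exact fun h => ht (by simp [h])
        exact (List.mem_cons.1 (hd t htd)).resolve_left hts
      · rw [herase k h₁ h₂, mul_zero]
      · omega
      · rfl
    rw [orderedProduct, convolution, map_sum, List.map_cons, blockCoeff,
      Finset.sum_congr rfl fun k hk => hterm k (Nat.lt_succ_iff.1 (Finset.mem_range.1 hk)),
      Finset.sum_ite_eq']
    simp only [Finset.mem_range, Nat.lt_succ_iff]

/-- The quasi-symmetric series whose coefficients are the products of the values of `c` on the
blocks of a word. -/
def blockSeries [LinearOrder σ] (c : List α → R) (w : List α) : MvPowerSeries σ R :=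
  fun d => blockCoeff c (d.support.sort.map d) w

-- Variables of exponent zero contribute blocks of length zero, on which `c` is `1`. Hence any
-- finite set of variables containing the support computes the coefficient, and infinite products
-- are avoided.
open MvPowerSeries in
theorem coeff_blockSeries [LinearOrder σ] {c : List α → R} (hc : c [] = 1) (w : List α)
    {d : σ →₀ ℕ} {s : Finset σ} (hd : d.support ⊆ s) :
    coeff d (blockSeries c w) = coeff d (orderedProduct c s.sort w) := by
  have hfilter : s.sort.filter (fun t => d t ≠ 0) = d.support.sort := by
    refine List.Perm.eq_of_pairwise' (r := (· ≤ ·)) ?_ (Finset.pairwise_sort _ _) ?_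
    · exact (Finset.pairwise_sort _ _).filter _
    · rw [List.perm_ext_iff_of_nodup ((Finset.sort_nodup _ _).filter _) (Finset.sort_nodup _ _)]
      intro t
      simpa using fun h => hd (Finsupp.mem_support_iff.2 h)
  rw [coeff_orderedProduct (Finset.sort_nodup _ _) w fun t ht => (Finset.mem_sort _).2 (hd ht),
    ← blockCoeff_filter_ne_zero hc, List.filter_map]
  change blockCoeff c _ w = _
  rw [← hfilter]
  rfl

open MvPowerSeries in
theorem isCharacter_blockSeries [LinearOrder σ] {c : List α → R} (hc : IsCharacter c) :
    IsCharacter (blockSeries (σ := σ) c) where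
  map_nil := by
    classical
    ext d
    rw [coeff_blockSeries hc.map_nil _ subset_rfl,
      (isCharacter_orderedProduct hc _).map_nil]
  map_shuffle u v := by
    classical
    ext d
    have hsum : coeff d (shuffleSum (blockSeries c) u v) =
        coeff d (shuffleSum (orderedProduct c d.support.sort) u v) := by
      simp only [shuffleSum, map_multiset_sum, Multiset.map_map]
      exact congrArg _ (Multiset.map_congr rfl fun w _ =>
        coeff_blockSeries hc.map_nil w subset_rfl)
    rw [hsum, (isCharacter_orderedProduct hc _).map_shuffle, coeff_mul, coeff_mul]
    refine Finset.sum_congr rfl fun p hp => ?_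
    -- Both summands are supported in `d.support`, so one finite ordered product computes all three
    -- coefficients.
    have hp : p.1 + p.2 = d := Finset.HasAntidiagonal.mem_antidiagonal.1 hp
    rw [coeff_blockSeries hc.map_nil u, coeff_blockSeries hc.map_nil v]
    · exact Finsupp.support_mono (hp ▸ le_add_self)
    · exact Finsupp.support_mono (hp ▸ le_self_add)

theorem isHomogeneous_blockSeries [LinearOrder σ] (c : List α → R) (w : List α) :
    (blockSeries (σ := σ) c w).IsHomogeneous w.length := by
  intro d hd
  rw [← sum_eq_length_of_blockCoeff_ne_zero (c := c) (w := w) hd, ← Multiset.sum_coe,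
    ← Multiset.map_coe, Finset.sort_eq, Pi.one_def, ← Finsupp.degree_eq_weight_one]
  rfl

end QuasiSymmetricSeries

/-! ### Coefficients and linear independence of quasi-monomial functions. -/

section QuasiMonomial

variable {σ : Type*} [LinearOrder σ]

/-- The composition of the nonzero exponents of a monomial, in the order of the variables. -/
def exponentComp (d : σ →₀ ℕ) : Comp :=
  d.support.sort.map fun s => (d s).toPNat'

theorem map_coe_exponentComp (d : σ →₀ ℕ) :
    (exponentComp d).map (fun i : ℕ+ => (i : ℕ)) = d.support.sort.map d := by
  rw [exponentComp, List.map_map]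
  refine List.map_congr_left fun s hs => ?_
  have hs : d s ≠ 0 := by simpa using hs
  exact PNat.toPNat'_coe (Nat.pos_of_ne_zero hs)

theorem monomialExponent_apply (J : Comp) (n : Fin J.length ↪o σ) (k : Fin J.length) :
    monomialExponent J n (n k) = J.get k := by
  simp [monomialExponent, Finsupp.finsetSum_apply, Finsupp.single_apply]

theorem support_monomialExponent (J : Comp) (n : Fin J.length ↪o σ) :
    (monomialExponent J n).support = Finset.univ.map n.toEmbedding := by
  ext s
  simp [monomialExponent, Finsupp.finsetSum_apply, Finsupp.single_apply]

theorem exponentComp_monomialExponent (J : Comp) (n : Fin J.length ↪o σ) :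
    exponentComp (monomialExponent J n) = J := by
  have hsort : (monomialExponent J n).support.sort = (List.finRange J.length).map n := by
    refine List.Perm.eq_of_pairwise' (r := (· ≤ ·)) (Finset.pairwise_sort _ _) ?_ ?_
    · rw [List.pairwise_map]
      exact (List.pairwise_le_finRange _).imp fun h => n.monotone h
    · rw [List.perm_ext_iff_of_nodup (Finset.sort_nodup _ _)
        ((List.nodup_finRange _).map n.injective)]
      simp [support_monomialExponent]
  rw [exponentComp, hsort, List.map_map]
  conv_rhs => rw [← List.map_get_finRange J]
  refine List.map_congr_left fun k _ => ?_
  simp only [Function.comp_apply, monomialExponent_apply, PNat.coe_toPNat']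

theorem exists_monomialExponent_eq_iff (J : Comp) (d : σ →₀ ℕ) :
    (∃ n : Fin J.length ↪o σ, monomialExponent J n = d) ↔ exponentComp d = J := by
  constructor
  · rintro ⟨n, rfl⟩
    exact exponentComp_monomialExponent J n
  · rintro rfl
    have hcard : d.support.card = (exponentComp d).length := by simp [exponentComp]
    refine ⟨d.support.orderEmbOfFin hcard, ?_⟩
    have hsupp : (monomialExponent _ (d.support.orderEmbOfFin hcard)).support = d.support := by
      rw [support_monomialExponent]
      exact Finset.map_orderEmbOfFin_univ _ hcard
    refine Finsupp.ext fun s => ?_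
    by_cases hs : s ∈ d.support
    · obtain ⟨k, rfl⟩ : s ∈ Set.range (d.support.orderEmbOfFin hcard) := by simpa using hs
      rw [monomialExponent_apply, List.get_eq_getElem]
      have hk : k < (d.support.sort.map d).length := by simpa [exponentComp] using k.2
      have h : (((exponentComp d)[(k : ℕ)] : ℕ+) : ℕ) = (d.support.sort.map d)[(k : ℕ)] := by
        simp only [← map_coe_exponentComp, List.getElem_map]
      rw [h, List.getElem_map, Finset.orderEmbOfFin_apply]
      rfl
    · rw [Finsupp.notMem_support_iff.1 hs, ← Finsupp.notMem_support_iff, hsupp]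
      exact hs

variable (σ) (K : Type*) [Field K]

open MvPowerSeries in
theorem coeff_quasiMonomial (J : Comp) (d : σ →₀ ℕ) :
    coeff d (quasiMonomial σ K J) = if exponentComp d = J then 1 else 0 := by
  classical
  rw [coeff_apply, quasiMonomial]
  simp only [exists_monomialExponent_eq_iff]

theorem exponentComp_surjective [Infinite σ] :
    Function.Surjective (exponentComp : (σ →₀ ℕ) → Comp) := fun J => by
  obtain ⟨n⟩ : Nonempty (Fin J.length ↪o σ) := nonempty_orderEmbedding_of_finite_infinite _ _
  exact ⟨_, exponentComp_monomialExponent J n⟩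

theorem linearIndependent_quasiMonomial [Infinite σ] :
    LinearIndependent K (quasiMonomial σ K) := by
  classical
  rw [linearIndependent_iff']
  intro s g h J hJ
  obtain ⟨d, rfl⟩ := exponentComp_surjective σ J
  simpa [coeff_quasiMonomial, hJ] using congrArg (MvPowerSeries.coeff d) h

end QuasiMonomial

/-! ### Triangular changes of basis. -/

section Triangular

variable {ι K V : Type*} [LinearOrder ι] [Field K] [AddCommGroup V] [Module K V]

/-- A family is a basis if it is triangular with nonzero diagonal entries with respect to a basis
whose index set is divided into finite linearly ordered pieces. -/
theorem exists_basis_of_triangular (b : Module.Basis ι K V) {z : ι → V} (ω : ι → ℕ)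
    (hfin : ∀ n, {i | ω i = n}.Finite) (hω : ∀ i j, b.repr (z i) j ≠ 0 → ω j = ω i)
    (hle : ∀ i j, b.repr (z i) j ≠ 0 → i ≤ j) (hdiag : ∀ i, b.repr (z i) i ≠ 0) :
    ∃ b' : Module.Basis ι K V, ⇑b' = z := by
  have hspan (n : ℕ) : ∀ i, ω i = n → b i ∈ Submodule.span K (Set.range z) := by
    -- Elimination runs from the largest index down; finiteness of each piece makes this terminate.
    have hwf : {i | ω i = n}.WellFoundedOn (· > ·) := (hfin n).wellFoundedOn
    intro i hi
    refine hwf.induction (P := fun i => b i ∈ Submodule.span K (Set.range z)) hi ?_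
    intro i hi ih
    have hz : z i ∈ Submodule.span K (Set.range z) := Submodule.subset_span ⟨i, rfl⟩
    rw [← Submodule.smul_mem_iff _ (hdiag i)]
    have hsum : b.repr (z i) i • b i =
        z i - ∑ j ∈ (b.repr (z i)).support.erase i, b.repr (z i) j • b j := by
      rw [eq_sub_iff_add_eq, Finset.add_sum_erase _ (fun j => b.repr (z i) j • b j)
        (Finsupp.mem_support_iff.2 (hdiag i))]
      exact b.linearCombination_repr (z i)
    rw [hsum]
    refine sub_mem hz (Submodule.sum_mem _ fun j hj => Submodule.smul_mem _ _ ?_)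
    obtain ⟨hji, hj⟩ := Finset.mem_erase.1 hj
    rw [Finsupp.mem_support_iff] at hj
    exact ih j ((hω i j hj).trans hi) (lt_of_le_of_ne (hle i j hj) hji.symm)
  have hli : LinearIndependent K z := by
    classical
    rw [linearIndependent_iff']
    intro s g hg
    by_contra! hne
    obtain ⟨i₀, hi₀, hgi₀⟩ := hne
    have hne : (s.filter fun i => g i ≠ 0).Nonempty := ⟨i₀, Finset.mem_filter.2 ⟨hi₀, hgi₀⟩⟩
    -- Only `z j` with `j ≤ m` can have an `m`-coordinate, so by minimality only `z m` contributes
    -- there.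
    set m := (s.filter fun i => g i ≠ 0).min' hne with hm
    obtain ⟨hms, hgm⟩ := Finset.mem_filter.1 (Finset.min'_mem _ hne)
    rw [← hm] at hms hgm
    have h := congrArg (fun v => b.repr v m) hg
    simp only [map_sum, map_smul, Finsupp.finsetSum_apply, Finsupp.smul_apply, smul_eq_mul,
      map_zero, Finsupp.zero_apply] at h
    rw [Finset.sum_eq_single_of_mem m hms] at h
    · exact mul_ne_zero hgm (hdiag m) h
    · intro j hj hjm
      by_contra hne'
      have hle' := hle j m (right_ne_zero_of_mul hne')
      have := Finset.min'_le (s.filter fun i => g i ≠ 0) j (Finset.mem_filter.2 ⟨hj, left_ne_zero_of_mul hne'⟩)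
      exact hjm (le_antisymm hle' this)
  refine ⟨Module.Basis.mk hli ?_, Module.Basis.coe_mk _ _⟩
  rw [← b.span_eq, Submodule.span_le]
  rintro _ ⟨i, rfl⟩
  exact hspan _ i rfl

end Triangular

/-! ### Binary words of compositions as the words not ending in `0`. -/

section BinaryWords

theorem binaryWord_cons (i : ℕ+) (I : Comp) :
    binaryWord (i :: I) = List.replicate ((i : ℕ) - 1) 0 ++ 1 :: binaryWord I := by
  simp [binaryWord]

theorem length_binaryWord (I : Comp) : (binaryWord I).length = I.weight := by
  induction I with
  | nil => rfl
  | cons i I ih =>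
    have := i.pos
    simp only [binaryWord_cons, List.length_append, List.length_replicate, List.length_cons, ih,
      Comp.weight, List.map_cons, List.sum_cons]
    omega

theorem finite_weight_eq (n : ℕ) : {I : Comp | I.weight = n}.Finite := by
  refine ((List.finite_length_eq (Fin 2) n).preimage binaryWord_injective.injOn).subset ?_
  intro I hI
  simpa [length_binaryWord] using hI

theorem mem_range_binaryWord_iff (w : List (Fin 2)) :
    w ∈ Set.range binaryWord ↔ ∀ a ∈ w.getLast?, a = 1 := by
  constructor
  · rintro ⟨I, rfl⟩
    induction I using List.reverseRecOn with
    | nil => simp [binaryWord]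
    | append_singleton I i => simp [binaryWord, List.getLast?_append]
  · intro h
    induction w with
    | nil => exact ⟨[], rfl⟩
    | cons a w ih =>
      by_cases hw : w = []
      · subst hw
        obtain rfl : a = 1 := by simpa using h
        exact ⟨[1], rfl⟩
      · obtain ⟨b, v, rfl⟩ := List.exists_cons_of_ne_nil hw
        rw [List.getLast?_cons_cons] at h
        obtain ⟨I, hI⟩ := ih h
        rw [← hI]
        fin_cases a
        · cases I with
          | nil => simp [binaryWord] at hI
          | cons i I =>
            refine ⟨(i + 1) :: I, ?_⟩
            have hi : ((i + 1 : ℕ+) : ℕ) - 1 = ((i : ℕ) - 1) + 1 := by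
              have := i.pos
              rw [PNat.add_coe, PNat.one_coe]
              omega
            rw [binaryWord_cons, binaryWord_cons, hi, List.replicate_succ]
            rfl
        · exact ⟨1 :: I, by simp [binaryWord_cons]⟩

theorem forall_getLast?_of_mem_shuffle {α : Type*} {P : α → Prop} {u v w : List α}
    (hu : ∀ a ∈ u.getLast?, P a) (hv : ∀ a ∈ v.getLast?, P a) (hw : w ∈ shuffle u v) :
    ∀ a ∈ w.getLast?, P a := by
  induction u, v using shuffle.induct generalizing w with
  | case1 v => simp_all
  | case2 a u => simp_all
  | case3 a u b v ih₁ ih₂ =>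
    simp only [shuffle_cons_cons, Multiset.mem_add, Multiset.mem_map] at hw
    have htail {c : α} {t : List α} (h : ∀ a ∈ (c :: t).getLast?, P a) :
        ∀ a ∈ t.getLast?, P a := by
      cases t <;> simp_all
    obtain ⟨w, hw, rfl⟩ | ⟨w, hw, rfl⟩ := hw
    · rw [List.getLast?_cons_of_ne_nil]
      · exact ih₁ (htail hu) hv hw
      · rintro rfl
        simpa using (perm_of_mem_shuffle hw).length_eq
    · rw [List.getLast?_cons_of_ne_nil]
      · exact ih₂ hu (htail hv) hw
      · rintro rfl
        simpa using (perm_of_mem_shuffle hw).length_eq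

theorem mem_range_binaryWord_of_mem_shuffle {I J : Comp} {w : List (Fin 2)}
    (hw : w ∈ shuffle (binaryWord I) (binaryWord J)) : w ∈ Set.range binaryWord := by
  rw [mem_range_binaryWord_iff]
  exact forall_getLast?_of_mem_shuffle ((mem_range_binaryWord_iff _).1 ⟨I, rfl⟩)
    ((mem_range_binaryWord_iff _).1 ⟨J, rfl⟩) hw

end BinaryWords

/-! ### Triangularity against the quasi-monomial basis. -/

section BlockBasis

variable (K : Type*) [Field K]

/-- The coefficient of the quasi-monomial function of `J` in the basis element of `I`. -/
noncomputable def transitionCoeff (I J : Comp) : K :=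
  blockCoeff (blockCharacter K) (J.map fun i : ℕ+ => (i : ℕ)) (binaryWord I)

variable {K}

theorem weight_eq_of_transitionCoeff_ne_zero {I J : Comp} (h : transitionCoeff K I J ≠ 0) :
    J.weight = I.weight := by
  rw [← length_binaryWord I]
  exact sum_eq_length_of_blockCoeff_ne_zero h

theorem transitionCoeff_cons_self (i : ℕ+) (I J : Comp) :
    transitionCoeff K (i :: I) (i :: J) =
      ((i : ℕ).factorial : K)⁻¹ * transitionCoeff K I J := by
  have hi : (i : ℕ) - 1 + 1 = i := Nat.succ_pred_eq_of_pos i.pos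
  have hword : binaryWord (i :: I) = (List.replicate ((i : ℕ) - 1) 0 ++ [1]) ++ binaryWord I := by
    simp [binaryWord_cons]
  have hlen : (List.replicate ((i : ℕ) - 1) (0 : Fin 2) ++ [1]).length = (i : ℕ) := by
    simp [hi]
  rw [transitionCoeff, List.map_cons, blockCoeff, hword, List.take_left' hlen,
    List.drop_left' hlen, blockCharacter_append_one, List.length_replicate, hi, if_pos]
  · rfl
  · rw [List.length_append, hlen]
    exact Nat.le_add_right _ _

variable (K) (σ : Type*) [LinearOrder σ]

theorem blockSeries_binaryWord (I : Comp) :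
    blockSeries (σ := σ) (blockCharacter K) (binaryWord I) =
      ∑ J ∈ (finite_weight_eq I.weight).toFinset, transitionCoeff K I J • quasiMonomial σ K J := by
  ext d
  have hd : MvPowerSeries.coeff d (blockSeries (blockCharacter K) (binaryWord I)) =
      transitionCoeff K I (exponentComp d) := by
    rw [transitionCoeff, map_coe_exponentComp]
    rfl
  rw [hd, map_sum, Finset.sum_congr rfl fun J _ => by
    rw [MvPowerSeries.coeff_smul, coeff_quasiMonomial, mul_ite, mul_one, mul_zero],
    Finset.sum_ite_eq]
  split_ifs with h
  · rfl
  · by_contra hne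
    exact h (by simpa using weight_eq_of_transitionCoeff_ne_zero hne)

variable {K}
variable [CharZero K]

theorem transitionCoeff_self_ne_zero (I : Comp) : transitionCoeff K I I ≠ 0 := by
  induction I with
  | nil => simp [transitionCoeff, blockCoeff, binaryWord]
  | cons i I ih =>
    rw [transitionCoeff_cons_self]
    exact mul_ne_zero (inv_ne_zero (Nat.cast_ne_zero.2 (Nat.factorial_ne_zero _))) ih

theorem le_of_transitionCoeff_ne_zero {I J : Comp} (h : transitionCoeff K I J ≠ 0) : I ≤ J := by
  induction J generalizing I with
  | nil =>
    cases I with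
    | nil => exact le_rfl
    | cons i I => simp [transitionCoeff, blockCoeff, binaryWord_cons] at h
  | cons j J ih =>
    cases I with
    | nil => exact (show ([] : Comp) < j :: J from List.Lex.nil).le
    | cons i I =>
      rcases lt_trichotomy i j with hij | rfl | hij
      · exact (show i :: I < j :: J from List.Lex.rel hij).le
      · rw [transitionCoeff_cons_self] at h
        exact List.cons_le_cons i (ih (right_ne_zero_of_mul h))
      -- As `j < i`, the first block of length `j` lies inside the initial run `0^{i-1}`, where the
      -- character vanishes.
      · refine absurd ?_ h
        have hij' : (j : ℕ) ≤ (i : ℕ) - 1 := Nat.le_pred_of_lt hij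
        rw [transitionCoeff, List.map_cons, blockCoeff, binaryWord_cons,
          List.take_append_of_le_length (by simpa using hij'), List.take_replicate,
          min_eq_left hij', blockCharacter_replicate_zero K j.ne_zero]
        simp

variable (K)

/-- The basis of quasi-monomial functions. -/
noncomputable def quasiMonomialBasis [Infinite σ] : Module.Basis Comp K (QSym σ K) :=
  Module.Basis.span (linearIndependent_quasiMonomial σ K)

/-- There is a basis of the quasi-symmetric functions consisting of the block series of the
binary words of compositions. -/
theorem exists_basis_eq_blockSeries [Infinite σ] :
    ∃ Z : Module.Basis Comp K (QSym σ K), ∀ I,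
      (Z I : MvPowerSeries σ K) = blockSeries (blockCharacter K) (binaryWord I) := by
  set b := quasiMonomialBasis K σ
  have hbI (I : Comp) : (b I : MvPowerSeries σ K) = quasiMonomial σ K I :=
    Module.Basis.coe_span_apply _ I
  let z (I : Comp) : QSym σ K :=
    ∑ J ∈ (finite_weight_eq I.weight).toFinset, transitionCoeff K I J • b J
  have hz (I J : Comp) : b.repr (z I) J = transitionCoeff K I J := by
    classical
    simp only [z, map_sum, map_smul, Module.Basis.repr_self, Finsupp.finsetSum_apply,
      Finsupp.smul_apply, Finsupp.single_apply, smul_eq_mul, mul_ite, mul_one, mul_zero,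
      Finset.sum_ite_eq']
    split_ifs with h
    · rfl
    · by_contra hne
      exact h (by simpa using weight_eq_of_transitionCoeff_ne_zero (Ne.symm hne))
  obtain ⟨Z, hZ⟩ := exists_basis_of_triangular b (z := z) Comp.weight finite_weight_eq
    (fun I J h => weight_eq_of_transitionCoeff_ne_zero (hz I J ▸ h))
    (fun I J h => le_of_transitionCoeff_ne_zero (hz I J ▸ h))
    (fun I => (hz I I).symm ▸ transitionCoeff_self_ne_zero I)
  refine ⟨Z, fun I => ?_⟩
  rw [hZ, blockSeries_binaryWord]
  simp [z, hbI]

end BlockBasis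

end BinaryShuffle

theorem mainTheorem4 (σ K : Type*) [LinearOrder σ] [Infinite σ] [Field K] [CharZero K] :
    ∃ Z : Module.Basis BinaryShuffle.Comp K (BinaryShuffle.QSym σ K),
      (∀ I : BinaryShuffle.Comp,
        (Z I : MvPowerSeries σ K).IsHomogeneous (BinaryShuffle.Comp.weight I)) ∧
      ∀ I J : BinaryShuffle.Comp,
        (Z I : MvPowerSeries σ K) * (Z J : MvPowerSeries σ K) =
          ∑ᶠ L : BinaryShuffle.Comp,
            ((BinaryShuffle.shuffle (BinaryShuffle.binaryWord I)
                (BinaryShuffle.binaryWord J)).count (BinaryShuffle.binaryWord L) : K) •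
              (Z L : MvPowerSeries σ K) := by
  obtain ⟨Z, hZ⟩ := BinaryShuffle.exists_basis_eq_blockSeries K σ
  refine ⟨Z, fun I => ?_, fun I J => ?_⟩
  · rw [hZ, ← BinaryShuffle.length_binaryWord]
    exact BinaryShuffle.isHomogeneous_blockSeries _ _
  · simp only [hZ]
    rw [← (BinaryShuffle.isCharacter_blockSeries
      (BinaryShuffle.isCharacter_blockCharacter K)).map_shuffle, BinaryShuffle.shuffleSum]
    set S := BinaryShuffle.shuffle (BinaryShuffle.binaryWord I) (BinaryShuffle.binaryWord J)
    -- The sum over compositions becomes a sum over the distinct words of `S`, each of which is the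
    -- word of a unique composition.
    rw [finsum_eq_sum_of_support_subset
      (s := S.toFinset.preimage BinaryShuffle.binaryWord BinaryShuffle.binaryWord_injective.injOn),
      Finset.sum_preimage _ _ _ fun w =>
        (S.count w : K) • BinaryShuffle.blockSeries (σ := σ) (BinaryShuffle.blockCharacter K) w,
      Finset.sum_multiset_map_count]
    · simp only [Nat.cast_smul_eq_nsmul]
    · intro w hw hw'
      exact absurd
        (BinaryShuffle.mem_range_binaryWord_of_mem_shuffle (Multiset.mem_toFinset.1 hw)) hw'
    · intro L hL
      rw [Function.mem_support] at hL
      rw [Finset.mem_coe, Finset.mem_preimage, Multiset.mem_toFinset]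
      by_contra hmem
      exact hL (by rw [Multiset.count_eq_zero_of_notMem hmem, Nat.cast_zero, zero_smul])
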